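/- Let $d\ge 1$ be an integer, let $\alpha\in(0,2)$, and let $\varkappa$ be a real number with $\varkappa>-\min(d,2)$. For $x\in\mathbb{R}^d$ put $$D(\varkappa,x)=\frac{1}{(2\pi)^d}\int_{\mathbb{R}^d}|\lambda|^{\varkappa}\exp\{i(x,\lambda)-|\lambda|^{\alpha}\}\,\mathrm{d}\lambda,$$ where $(\cdot,\cdot)$ and $|\cdot|$ are the Euclidean inner product and norm. Then this integral converges absolutely for every $x\in\mathbb{R}^d$, and $$\lim_{|x|\to+\infty}|x|^{d+\varkappa}D(\varkappa,x)=\frac{2^{\varkappa}}{\pi^{\frac d2+1}}\,\Gamma\left(\frac{d+\varkappa}{2}\right)\Gamma\left(\frac{\varkappa}{2}+1\right)\cos\frac{(\varkappa+1)\pi}{2}.$$ -/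

import Mathlib

/-- The integrand `|lam|^ϰ exp (i (x, lam) - |lam|^α)` on `ℝ^d`. -/
noncomputable def stableIntegrand (d : ℕ) (α ϰ : ℝ) (x lam : EuclideanSpace ℝ (Fin d)) : ℂ :=
  ((‖lam‖ ^ ϰ : ℝ) : ℂ) *
    Complex.exp (Complex.I * ((inner ℝ x lam : ℝ) : ℂ) - ((‖lam‖ ^ α : ℝ) : ℂ))

/-- `D(ϰ, x) = (2π)^(-d) ∫ |lam|^ϰ exp (i (x, lam) - |lam|^α) d lam`, the inverse Fourier transform
of `|lam|^ϰ exp (-|lam|^α)`. -/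
noncomputable def stableD (d : ℕ) (α ϰ : ℝ) (x : EuclideanSpace ℝ (Fin d)) : ℂ :=
  (1 / (2 * (Real.pi : ℂ)) ^ d) *
    ∫ lam : EuclideanSpace ℝ (Fin d), stableIntegrand d α ϰ x lam

open MeasureTheory Filter Topology Set ProbabilityTheory

/-! Put β = α/2 < 1. The function exp(-s^β) is the Laplace transform of a probability measure μ on
(0, ∞), so the stable damping exp(-|λ|^α) is a μ-mixture of Gaussians exp(-u|λ|²). After the
substitution λ = v/r with r = |x| and θ = x/r, the quantity r^(d+ϰ) ∫ |λ|^ϰ exp(i(x,λ) - |λ|^α) dλ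
becomes ∫ Φ(u/r²) dμ(u), where Φ(δ) is the Fourier transform of |v|^ϰ exp(-δ|v|²) at a unit vector.
If Φ is bounded on (0, ∞) and has a limit at 0+, dominated convergence gives the result, and α
disappears from the answer.

To control Φ, choose an integer k > ϰ/2 with k ≥ 0 and write |v|^ϰ as |v|^(2k) times a Gamma
integral of exp(-t|v|²). The Fourier transform of |v|^(2k) exp(-t|v|²) at a unit vector is π^(d/2)
H_k(t), with H_k = (-d/dt)^k (t^(-d/2) e^(-1/(4t))), which is `heatKer`. Hence Φ(δ) is a constant
times ∫ t^(k-ϰ/2-1) H_k(δ+t) dt. This integral converges absolutely and uniformly in δ: H_k is flat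
at 0 and O(t^(-d/2-k)) at infinity. At δ = 0, k integrations by parts reduce it to a Gamma integral,
and the reflection formula produces the cosine.

The main ingredients are `exists_measure_integral_exp_eq_exp_neg_rpow`,
`integral_norm_rpow_mul_exp_sq_mul_cexp`, `exists_abs_integral_rpow_mul_heatKer_add_le` and
`inv_Gamma_mul_integral_rpow_mul_heatKer`. -/

/-! ### Subordination: the one-sided stable law as a limit of Pareto sums. -/

/-- The Lévy integral `∫₀^∞ (1 - e^{-su}) u^{-β-1} du` converges. -/
theorem integrableOn_one_sub_exp_mul_rpow {β s : ℝ} (hβ0 : 0 < β) (hβ1 : β < 1) (hs : 0 < s) :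
    IntegrableOn (fun u : ℝ => (1 - Real.exp (-(s * u))) * u ^ (-(β + 1))) (Ioi 0) := by
  have hm : Measurable (fun u : ℝ => (1 - Real.exp (-(s * u))) * u ^ (-(β + 1))) := by fun_prop
  rw [← Ioc_union_Ioi_eq_Ioi zero_le_one]
  refine IntegrableOn.union ?_ ?_
  · have h1 : IntegrableOn (fun u : ℝ => s * u ^ (-β)) (Ioc 0 1) :=
      ((intervalIntegrable_iff_integrableOn_Ioc_of_le zero_le_one).1
        (intervalIntegral.intervalIntegrable_rpow' (by linarith))).const_mul s
    refine h1.mono' hm.aestronglyMeasurable ?_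
    filter_upwards [ae_restrict_mem measurableSet_Ioc] with u hu
    have hexp : 1 - Real.exp (-(s * u)) ≤ s * u := by
      linarith [Real.add_one_le_exp (-(s * u))]
    have hexp0 : 0 ≤ 1 - Real.exp (-(s * u)) := by
      have := Real.exp_le_one_iff.2 (show -(s * u) ≤ 0 by nlinarith [hu.1])
      linarith
    have hp : 0 < u ^ (-(β + 1)) := Real.rpow_pos_of_pos hu.1 _
    rw [Real.norm_of_nonneg (by positivity)]
    calc _ ≤ s * u * u ^ (-(β + 1)) := by gcongr
      _ = s * u ^ (-β) := by
        rw [mul_assoc, ← Real.rpow_one_add' hu.1.le (by linarith)]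
        congr 2; ring
  · refine (integrableOn_Ioi_rpow_of_lt (show -(β + 1) < -1 by linarith) zero_lt_one).mono'
      hm.aestronglyMeasurable ?_
    filter_upwards [ae_restrict_mem measurableSet_Ioi] with u hu
    have hu0 : 0 < u := zero_lt_one.trans hu
    have hexp0 : 0 ≤ 1 - Real.exp (-(s * u)) := by
      have := Real.exp_le_one_iff.2 (show -(s * u) ≤ 0 by nlinarith)
      linarith
    have hp : 0 < u ^ (-(β + 1)) := Real.rpow_pos_of_pos hu0 _
    rw [Real.norm_of_nonneg (by positivity)]
    have : 1 - Real.exp (-(s * u)) ≤ 1 := by linarith [Real.exp_pos (-(s * u))]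
    nlinarith

theorem integral_one_sub_exp_mul_rpow_pos {β : ℝ} (hβ0 : 0 < β) (hβ1 : β < 1) :
    0 < ∫ u in Ioi (0 : ℝ), (1 - Real.exp (-u)) * u ^ (-(β + 1)) := by
  have hpos : ∀ u : ℝ, 0 < u → 0 < (1 - Real.exp (-u)) * u ^ (-(β + 1)) := fun u hu =>
    mul_pos (sub_pos.2 (Real.exp_lt_one_iff.2 (neg_lt_zero.2 hu))) (Real.rpow_pos_of_pos hu _)
  have hint := integrableOn_one_sub_exp_mul_rpow hβ0 hβ1 one_pos
  simp only [one_mul] at hint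
  rw [setIntegral_pos_iff_support_of_nonneg_ae _ hint]
  · have : Function.support (fun u : ℝ => (1 - Real.exp (-u)) * u ^ (-(β + 1))) ∩ Ioi 0 = Ioi 0 :=
      inter_eq_right.2 fun u hu => (hpos u hu).ne'
    rw [this]
    simp
  · filter_upwards [ae_restrict_mem measurableSet_Ioi] with u hu using (hpos u hu).le

/-- Scaling of the Lévy integral: it equals a constant times `s ^ β`. -/
theorem integral_one_sub_exp_mul_rpow {β s : ℝ} (hs : 0 < s) :
    ∫ u in Ioi (0 : ℝ), (1 - Real.exp (-(s * u))) * u ^ (-(β + 1)) =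
      s ^ β * ∫ u in Ioi (0 : ℝ), (1 - Real.exp (-u)) * u ^ (-(β + 1)) := by
  have h := integral_comp_mul_left_Ioi
    (fun u : ℝ => (1 - Real.exp (-u)) * u ^ (-(β + 1))) 0 hs
  rw [mul_zero, smul_eq_mul] at h
  have h2 : ∫ u in Ioi (0 : ℝ), (1 - Real.exp (-(s * u))) * (s * u) ^ (-(β + 1)) =
      s ^ (-(β + 1)) * ∫ u in Ioi (0 : ℝ), (1 - Real.exp (-(s * u))) * u ^ (-(β + 1)) := by
    rw [← integral_const_mul]
    refine setIntegral_congr_fun measurableSet_Ioi fun u hu => ?_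
    rw [Real.mul_rpow hs.le (le_of_lt hu)]
    ring
  rw [h2] at h
  have h4 : s ^ (-(β + 1)) = (s ^ β)⁻¹ * s⁻¹ := by
    rw [Real.rpow_neg hs.le, Real.rpow_add hs, Real.rpow_one, mul_inv]
  have := (Real.rpow_pos_of_pos hs β).ne'
  rw [h4] at h
  field_simp at h
  linarith

theorem ae_nonneg_paretoMeasure {β t : ℝ} (ht : 0 < t) :
    ∀ᵐ u ∂(paretoMeasure t β), 0 ≤ u := by
  rw [paretoMeasure, ae_withDensity_iff (by unfold paretoPDF; fun_prop)]
  refine ae_of_all _ fun u hu => ?_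
  by_contra hlt
  exact hu (paretoPDF_of_lt (by linarith))

/-- The Laplace transform of the Pareto distribution. -/
theorem integral_exp_paretoMeasure {β t s : ℝ} (hβ0 : 0 < β) (ht : 0 < t) (hs : 0 < s) :
    ∫ u, Real.exp (-(s * u)) ∂(paretoMeasure t β) =
      1 - β * t ^ β * ∫ u in Ioi t, (1 - Real.exp (-(s * u))) * u ^ (-(β + 1)) := by
  have := isProbabilityMeasure_paretoMeasure ht hβ0
  have hdens : ∀ f : ℝ → ℝ, ∫ u, f u ∂(paretoMeasure t β) =
      ∫ u in Ioi t, β * t ^ β * (f u * u ^ (-(β + 1))) := by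
    intro f
    rw [paretoMeasure, integral_withDensity_eq_integral_toReal_smul
      (by unfold paretoPDF; fun_prop) (by simp [paretoPDF]), ← integral_Ici_eq_integral_Ioi,
      ← integral_indicator measurableSet_Ici]
    refine integral_congr_ae (ae_of_all _ fun u => ?_)
    simp only [paretoPDF]
    rw [ENNReal.toReal_ofReal (paretoPDFReal_nonneg ht.le hβ0.le u)]
    simp only [paretoPDFReal, indicator, mem_Ici, smul_eq_mul]
    split_ifs <;> ring
  have hint : Integrable (fun u => Real.exp (-(s * u))) (paretoMeasure t β) := by
    refine Integrable.of_bound (by fun_prop) 1 ?_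
    filter_upwards [ae_nonneg_paretoMeasure ht] with u hu
    rw [Real.norm_of_nonneg (Real.exp_pos _).le]
    exact Real.exp_le_one_iff.2 (by nlinarith)
  have h1 : ∫ u, (1 - Real.exp (-(s * u))) ∂(paretoMeasure t β) =
      1 - ∫ u, Real.exp (-(s * u)) ∂(paretoMeasure t β) := by
    rw [integral_sub (integrable_const _) hint]
    simp
  rw [hdens, integral_const_mul] at h1
  linarith

/-- The set of functions `s ↦ ∫ w ^ s` for probability measures on `[0, 1]` is stable under
multiplication, hence under powers. -/
theorem exists_probabilityMeasure_integral_rpow_pow (ρ : ProbabilityMeasure unitInterval) (n : ℕ) :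
    ∃ ν : ProbabilityMeasure unitInterval, ∀ s : ℝ, 0 < s →
      ∫ w : unitInterval, (w : ℝ) ^ s ∂(ν : Measure unitInterval) =
        (∫ w : unitInterval, (w : ℝ) ^ s ∂(ρ : Measure unitInterval)) ^ n := by
  induction n with
  | zero => exact ⟨⟨Measure.dirac 1, inferInstance⟩, fun s _ => by simp⟩
  | succ n ih =>
    obtain ⟨ν, hν⟩ := ih
    refine ⟨⟨((ν : Measure unitInterval).prod (ρ : Measure unitInterval)).map
      (fun p => p.1 * p.2), Measure.isProbabilityMeasure_map (by fun_prop)⟩, fun s hs => ?_⟩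
    have hc : Continuous (fun w : unitInterval => (w : ℝ) ^ s) :=
      continuous_subtype_val.rpow_const fun _ => Or.inr hs.le
    rw [ProbabilityMeasure.coe_mk, integral_map (by fun_prop) hc.aestronglyMeasurable, pow_succ,
      ← hν s hs, ← integral_prod_mul]
    refine integral_congr_ae (ae_of_all _ fun p => ?_)
    simp only [Icc.coe_mul]
    exact Real.mul_rpow p.1.2.1 p.2.2.1

/-- The image of the Pareto distribution under `u ↦ e^{-u}`. -/
theorem exists_probabilityMeasure_integral_rpow_pareto {β t : ℝ} (hβ0 : 0 < β) (ht : 0 < t) :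
    ∃ ρ : ProbabilityMeasure unitInterval, ∀ s : ℝ, 0 < s →
      ∫ w : unitInterval, (w : ℝ) ^ s ∂(ρ : Measure unitInterval) =
        1 - β * t ^ β * ∫ u in Ioi t, (1 - Real.exp (-(s * u))) * u ^ (-(β + 1)) := by
  have := isProbabilityMeasure_paretoMeasure ht hβ0
  -- The projection only supplies the type: e^{-u} already lies in [0, 1] for almost every u.
  let f : ℝ → unitInterval := fun u => projIcc 0 1 zero_le_one (Real.exp (-u))
  have hf : Measurable f := (continuous_projIcc.comp (by fun_prop)).measurable
  refine ⟨⟨(paretoMeasure t β).map f, Measure.isProbabilityMeasure_map hf.aemeasurable⟩,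
    fun s hs => ?_⟩
  have hc : Continuous (fun w : unitInterval => (w : ℝ) ^ s) :=
    continuous_subtype_val.rpow_const fun _ => Or.inr hs.le
  rw [ProbabilityMeasure.coe_mk, integral_map hf.aemeasurable hc.aestronglyMeasurable,
    ← integral_exp_paretoMeasure hβ0 ht hs]
  refine integral_congr_ae ?_
  filter_upwards [ae_nonneg_paretoMeasure ht] with u hu
  have : (f u : ℝ) = Real.exp (-u) := by
    simp only [f]
    rw [projIcc_of_mem zero_le_one
      ⟨(Real.exp_pos _).le, Real.exp_le_one_iff.2 (by linarith)⟩]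
  rw [this, ← Real.exp_mul]
  congr 1
  ring

/-- The stable law arises from sums of n independent Pareto variables with shrinking threshold. In
the coordinate w = e^{-u} sums become products, Laplace transforms become moments w^s, and the space
[0, 1] is compact, so a limit law exists without a tightness argument. -/
theorem exists_probabilityMeasure_integral_rpow_eq_exp_neg_rpow {β : ℝ} (hβ0 : 0 < β)
    (hβ1 : β < 1) :
    ∃ K : ℝ, 0 < K ∧ ∃ ν : ProbabilityMeasure unitInterval, ∀ s : ℝ, 0 < s →
      ∫ w : unitInterval, (w : ℝ) ^ s ∂(ν : Measure unitInterval) = Real.exp (-(K * s ^ β)) := by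
  set c := ∫ u in Ioi (0 : ℝ), (1 - Real.exp (-u)) * u ^ (-(β + 1)) with hc
  have hc0 : 0 < c := integral_one_sub_exp_mul_rpow_pos hβ0 hβ1
  -- This threshold gives t_n^β = 1/(n+1), so the nth power of 1 - β t_n^β (…) has an exponential
  -- limit.
  let t : ℕ → ℝ := fun n => ((n : ℝ) + 1) ^ (-(1 / β))
  have ht : ∀ n, 0 < t n := fun n => by positivity
  have htβ : ∀ n, t n ^ β = ((n : ℝ) + 1)⁻¹ := fun n => by
    simp only [t]
    rw [← Real.rpow_mul (by positivity), show -(1 / β) * β = -1 by field_simp, Real.rpow_neg_one]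
  choose ρ hρ using fun n => exists_probabilityMeasure_integral_rpow_pareto hβ0 (ht n)
  choose ν hν using fun n => exists_probabilityMeasure_integral_rpow_pow (ρ n) n
  have htend : Tendsto t atTop (𝓝 0) :=
    (tendsto_rpow_neg_atTop (by positivity)).comp
      (tendsto_atTop_add_const_right _ _ tendsto_natCast_atTop_atTop)
  have hanti : Antitone t := fun m n hmn => by
    refine Real.rpow_le_rpow_of_nonpos (by positivity) (by gcongr) ?_
    have : 0 < 1 / β := by positivity
    linarith
  have hlim : ∀ s : ℝ, 0 < s → Tendsto (fun n =>
      ∫ w : unitInterval, (w : ℝ) ^ s ∂(ν n : Measure unitInterval)) atTop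
      (𝓝 (Real.exp (-(β * c * s ^ β)))) := by
    intro s hs
    simp_rw [hν _ s hs, hρ _ s hs, sub_eq_add_neg (1 : ℝ) (β * _ * _)]
    refine Real.tendsto_one_add_pow_exp_of_tendsto ?_
    have hU : ⋃ n, Ioi (t n) = Ioi 0 := by
      ext u
      simp only [mem_iUnion, mem_Ioi]
      exact ⟨fun ⟨n, hn⟩ => (ht n).trans hn, fun hu => (htend.eventually_lt_const hu).exists⟩
    have h1 : Tendsto (fun n => ∫ u in Ioi (t n), (1 - Real.exp (-(s * u))) * u ^ (-(β + 1)))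
        atTop (𝓝 (s ^ β * c)) := by
      have := tendsto_setIntegral_of_monotone (μ := volume)
        (f := fun u : ℝ => (1 - Real.exp (-(s * u))) * u ^ (-(β + 1)))
        (s := fun n => Ioi (t n)) (fun n => measurableSet_Ioi)
        (fun m n hmn => Ioi_subset_Ioi (hanti hmn))
        (by rw [hU]; exact integrableOn_one_sub_exp_mul_rpow hβ0 hβ1 hs)
      rwa [hU, integral_one_sub_exp_mul_rpow hs] at this
    have h2 := ((tendsto_natCast_div_add_atTop (1 : ℝ)).mul (h1.const_mul β)).neg
    convert h2 using 2
    · rw [htβ]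
      field_simp
    · ring_nf
  -- Compactness of the space of probability measures gives a limit along any ultrafilter; a free
  -- one inherits the limits of the moments.
  let F : Ultrafilter (ProbabilityMeasure unitInterval) := (hyperfilter ℕ).map ν
  refine ⟨β * c, by positivity, F.lim, fun s hs => ?_⟩
  have hF : Tendsto ν (hyperfilter ℕ) (𝓝 F.lim) := F.le_nhds_lim
  let g : BoundedContinuousFunction unitInterval ℝ := BoundedContinuousFunction.mkOfCompact
    ⟨fun w : unitInterval => (w : ℝ) ^ s,
      continuous_subtype_val.rpow_const fun _ => Or.inr hs.le⟩
  exact tendsto_nhds_unique (ProbabilityMeasure.tendsto_iff_forall_integral_tendsto.1 hF g)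
    ((hlim s hs).mono_left Nat.hyperfilter_le_atTop)

/-- **Subordination**: `exp (-s ^ β)` is the Laplace transform of a probability measure on the
positive half-line when `0 < β < 1`. -/
theorem exists_measure_integral_exp_eq_exp_neg_rpow {β : ℝ} (hβ0 : 0 < β) (hβ1 : β < 1) :
    ∃ μ : Measure ℝ, IsProbabilityMeasure μ ∧ (∀ᵐ u ∂μ, 0 < u) ∧
      ∀ s : ℝ, 0 < s → ∫ u, Real.exp (-(u * s)) ∂μ = Real.exp (-s ^ β) := by
  obtain ⟨K, hK, ν, hν⟩ := exists_probabilityMeasure_integral_rpow_eq_exp_neg_rpow hβ0 hβ1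
  have hcont : ∀ s : ℝ, 0 < s → Continuous (fun w : unitInterval => (w : ℝ) ^ s) := fun s hs =>
    continuous_subtype_val.rpow_const fun _ => Or.inr hs.le
  have hint : ∀ s : ℝ, 0 < s →
      Integrable (fun w : unitInterval => (w : ℝ) ^ s) (ν : Measure unitInterval) := fun s hs =>
    Integrable.of_bound (hcont s hs).aestronglyMeasurable 1 (ae_of_all _ fun w => by
      rw [Real.norm_of_nonneg (Real.rpow_nonneg w.2.1 _)]
      exact Real.rpow_le_one w.2.1 w.2.2 hs.le)
  -- An atom at w = 0 is mass escaped to u = ∞; it is excluded by letting s → 0+.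
  have hzero : (ν : Measure unitInterval) {0} = 0 := by
    have hle : ∀ s : ℝ, 0 < s →
        (ν : Measure unitInterval).real {0} ≤ 1 - Real.exp (-(K * s ^ β)) := by
      intro s hs
      have h1 : ∫ w : unitInterval, (({0} : Set unitInterval).indicator 1 w : ℝ)
          ∂(ν : Measure unitInterval) ≤
          ∫ w : unitInterval, (1 - (w : ℝ) ^ s) ∂(ν : Measure unitInterval) := by
        refine integral_mono ((integrable_const (1 : ℝ)).indicator (measurableSet_singleton _))
          ((integrable_const 1).sub (hint s hs)) fun w => ?_
        by_cases hw : w = 0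
        · simp [hw, Real.zero_rpow hs.ne']
        · simp [hw, Real.rpow_le_one w.2.1 w.2.2 hs.le]
      rw [integral_indicator_one (measurableSet_singleton _),
        integral_sub (integrable_const 1) (hint s hs), hν s hs] at h1
      simpa using h1
    have hl : Tendsto (fun s : ℝ => 1 - Real.exp (-(K * s ^ β))) (𝓝[>] 0) (𝓝 0) := by
      have : Tendsto (fun s : ℝ => 1 - Real.exp (-(K * s ^ β))) (𝓝 0)
          (𝓝 (1 - Real.exp (-(K * 0 ^ β)))) := by
        refine Continuous.tendsto ?_ 0
        have : Continuous fun s : ℝ => s ^ β :=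
          continuous_id.rpow_const fun _ => Or.inr hβ0.le
        fun_prop
      rw [Real.zero_rpow hβ0.ne'] at this
      simpa using this.mono_left nhdsWithin_le_nhds
    have h0 : (ν : Measure unitInterval).real {0} ≤ 0 :=
      ge_of_tendsto hl (by filter_upwards [self_mem_nhdsWithin] with s hs using hle s hs)
    exact (measureReal_eq_zero_iff).1 (le_antisymm h0 measureReal_nonneg)
  -- An atom at w = 1 is an atom at u = 0; it is excluded by letting s → ∞.
  have hone : (ν : Measure unitInterval) {1} = 0 := by
    have hle : ∀ s : ℝ, 0 < s →
        (ν : Measure unitInterval).real {1} ≤ Real.exp (-(K * s ^ β)) := by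
      intro s hs
      rw [← hν s hs, ← integral_indicator_one (measurableSet_singleton _)]
      refine integral_mono ((integrable_const (1 : ℝ)).indicator (measurableSet_singleton _))
        (hint s hs) fun w => ?_
      by_cases hw : w = 1
      · simp [hw]
      · simp [hw, Real.rpow_nonneg w.2.1 s]
    have hl : Tendsto (fun s : ℝ => Real.exp (-(K * s ^ β))) atTop (𝓝 0) :=
      Real.tendsto_exp_neg_atTop_nhds_zero.comp ((tendsto_rpow_atTop hβ0).const_mul_atTop hK)
    have h0 : (ν : Measure unitInterval).real {1} ≤ 0 :=
      ge_of_tendsto hl (by filter_upwards [eventually_gt_atTop 0] with s hs using hle s hs)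
    exact (measureReal_eq_zero_iff).1 (le_antisymm h0 measureReal_nonneg)
  have hae : ∀ᵐ w : unitInterval ∂(ν : Measure unitInterval), 0 < (w : ℝ) ∧ (w : ℝ) < 1 := by
    have h0 : ∀ᵐ w ∂(ν : Measure unitInterval), w ≠ 0 := by simpa [ae_iff] using hzero
    have h1 : ∀ᵐ w ∂(ν : Measure unitInterval), w ≠ 1 := by simpa [ae_iff] using hone
    filter_upwards [h0, h1] with w hw0 hw1
    exact ⟨unitInterval.pos_iff_ne_zero.2 hw0, unitInterval.lt_one_iff_ne_one.2 hw1⟩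
  -- Rescaling u = -log w by c normalises K to 1.
  set c := K ^ (-(1 / β)) with hc
  have hc0 : 0 < c := by positivity
  have hcβ : K * c ^ β = 1 := by
    rw [hc, ← Real.rpow_mul hK.le, show -(1 / β) * β = -1 by field_simp, Real.rpow_neg_one,
      mul_inv_cancel₀ hK.ne']
  have hmeas : Measurable (fun w : unitInterval => -(c * Real.log w)) := by fun_prop
  refine ⟨(ν : Measure unitInterval).map (fun w : unitInterval => -(c * Real.log w)),
    Measure.isProbabilityMeasure_map hmeas.aemeasurable, ?_, fun s hs => ?_⟩
  · rw [ae_map_iff hmeas.aemeasurable measurableSet_Ioi]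
    filter_upwards [hae] with w hw
    nlinarith [Real.log_neg hw.1 hw.2]
  · rw [integral_map hmeas.aemeasurable (by fun_prop)]
    have h1 := hν (c * s) (by positivity)
    rw [Real.mul_rpow hc0.le hs.le, ← mul_assoc, hcβ, one_mul] at h1
    rw [← h1]
    refine integral_congr_ae ?_
    filter_upwards [hae] with w hw
    rw [Real.rpow_def_of_pos hw.1]
    congr 1
    ring

/-! ### Derivatives of the heat kernel in time and their Mellin transforms. -/

section HeatKernel

/-- The polynomials `R_k` with
`(-d/dt)^k (t ^ (-b) e^{-1/(4t)}) = t ^ (-(b + k)) R_k(1/t) e^{-1/(4t)}`. -/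
noncomputable def heatPoly (b : ℝ) : ℕ → Polynomial ℝ
  | 0 => 1
  | k + 1 => Polynomial.C (b + k) * heatPoly b k +
      Polynomial.X * Polynomial.derivative (heatPoly b k) -
      Polynomial.C (1 / 4) * Polynomial.X * heatPoly b k

/-- The function `(-d/dt)^k (t ^ (-b) e^{-1/(4t)})`. -/
noncomputable def heatKer (b : ℝ) (k : ℕ) (t : ℝ) : ℝ :=
  t ^ (-(b + k)) * (heatPoly b k).eval t⁻¹ * Real.exp (-(t⁻¹ / 4))

theorem hasDerivAt_heatKer (b : ℝ) (k : ℕ) {t : ℝ} (ht : 0 < t) :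
    HasDerivAt (heatKer b k) (-heatKer b (k + 1) t) t := by
  have hinv : HasDerivAt (fun t : ℝ => t⁻¹) (-(t ^ 2)⁻¹) t := hasDerivAt_inv ht.ne'
  have h1 : HasDerivAt (fun t : ℝ => t ^ (-(b + k))) (-(b + k) * t ^ (-(b + k) - 1)) t :=
    Real.hasDerivAt_rpow_const (Or.inl ht.ne')
  have h2 : HasDerivAt (fun t : ℝ => (heatPoly b k).eval t⁻¹)
      ((heatPoly b k).derivative.eval t⁻¹ * -(t ^ 2)⁻¹) t :=
    ((heatPoly b k).hasDerivAt t⁻¹).comp t hinv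
  have h3 : HasDerivAt (fun t : ℝ => Real.exp (-(t⁻¹ / 4)))
      (Real.exp (-(t⁻¹ / 4)) * -(-(t ^ 2)⁻¹ / 4)) t := ((hinv.div_const 4).neg).exp
  refine ((h1.mul h2).mul h3).congr_deriv ?_
  have hp : t ^ (-(b + k) - 1) = t ^ (-(b + k)) * t⁻¹ := by
    rw [Real.rpow_sub ht, Real.rpow_one, div_eq_mul_inv]
  have hp' : t ^ (-(b + (k + 1 : ℕ))) = t ^ (-(b + k)) * t⁻¹ := by
    rw [← hp]; congr 1; push_cast; ring
  simp only [heatKer, hp', hp, heatPoly, Polynomial.eval_add, Polynomial.eval_sub,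
    Polynomial.eval_mul, Polynomial.eval_C, Polynomial.eval_X, Pi.mul_apply]
  ring

theorem measurable_heatKer (b : ℝ) (k : ℕ) : Measurable (heatKer b k) := by
  unfold heatKer
  have : Measurable fun t : ℝ => (heatPoly b k).eval t⁻¹ :=
    (heatPoly b k).continuous.measurable.comp measurable_inv
  fun_prop

theorem exists_rpow_mul_exp_neg_le {m : ℝ} (hm : 0 ≤ m) :
    ∃ C : ℝ, ∀ z : ℝ, 0 < z → z ^ m * Real.exp (-(z / 4)) ≤ C := by
  obtain ⟨M, hM⟩ := eventually_atTop.1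
    ((tendsto_rpow_mul_exp_neg_mul_atTop_nhds_zero m (1 / 4) (by norm_num)).eventually_le_const
      one_pos)
  refine ⟨max 1 (M ^ m), fun z hz => ?_⟩
  rcases le_total M z with h | h
  · refine le_max_of_le_left ?_
    have := hM z h
    rwa [show -(z / 4) = -(1 / 4) * z by ring]
  · refine le_max_of_le_right ?_
    calc z ^ m * Real.exp (-(z / 4)) ≤ z ^ m * 1 := by
          gcongr
          exact Real.exp_le_one_iff.2 (by linarith)
      _ ≤ M ^ m := by rw [mul_one]; gcongr

theorem exists_rpow_mul_abs_eval_mul_exp_neg_le (P : Polynomial ℝ) {a : ℝ} (ha : 0 ≤ a) :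
    ∃ C : ℝ, ∀ z : ℝ, 0 < z → z ^ a * |P.eval z| * Real.exp (-(z / 4)) ≤ C := by
  induction P using Polynomial.induction_on' with
  | add P Q hP hQ =>
    obtain ⟨C, hC⟩ := hP
    obtain ⟨D, hD⟩ := hQ
    refine ⟨C + D, fun z hz => ?_⟩
    calc z ^ a * |(P + Q).eval z| * Real.exp (-(z / 4))
        ≤ z ^ a * (|P.eval z| + |Q.eval z|) * Real.exp (-(z / 4)) := by
          rw [Polynomial.eval_add]
          gcongr
          exact abs_add_le _ _
      _ ≤ C + D := by linarith [hC z hz, hD z hz]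
  | monomial n c =>
    obtain ⟨C, hC⟩ := exists_rpow_mul_exp_neg_le (show 0 ≤ a + n by positivity)
    refine ⟨|c| * C, fun z hz => ?_⟩
    rw [Polynomial.eval_monomial, abs_mul, abs_of_pos (pow_pos hz n)]
    have := hC z hz
    rw [Real.rpow_add hz, Real.rpow_natCast] at this
    calc z ^ a * (|c| * z ^ n) * Real.exp (-(z / 4))
        = |c| * (z ^ a * z ^ n * Real.exp (-(z / 4))) := by ring
      _ ≤ |c| * C := by gcongr

/-- The factor e^{-1/(4t)} absorbs any power of 1/t, so a is free: a = 0 serves for large t, a large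
a for small t. -/
theorem exists_abs_heatKer_le (b : ℝ) (k : ℕ) {a : ℝ} (ha : 0 ≤ a) :
    ∃ C : ℝ, 0 ≤ C ∧ ∀ t : ℝ, 0 < t → |heatKer b k t| ≤ C * t ^ (a - (b + k)) := by
  obtain ⟨C, hC⟩ := exists_rpow_mul_abs_eval_mul_exp_neg_le (heatPoly b k) ha
  refine ⟨max C 0, le_max_right _ _, fun t ht => ?_⟩
  have h := hC t⁻¹ (inv_pos.2 ht)
  have hta : 0 < t ^ a := Real.rpow_pos_of_pos ht a
  have htb : 0 < t ^ (-(b + k)) := Real.rpow_pos_of_pos ht _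
  rw [Real.inv_rpow ht.le] at h
  have hEq : |heatKer b k t| = ((t ^ a)⁻¹ * |(heatPoly b k).eval t⁻¹| * Real.exp (-(t⁻¹ / 4))) *
      (t ^ a * t ^ (-(b + k))) := by
    rw [heatKer, abs_mul, abs_mul, abs_of_pos htb, abs_of_pos (Real.exp_pos _)]
    field_simp
  rw [hEq, sub_eq_add_neg, Real.rpow_add ht]
  gcongr
  exact h.trans (le_max_left _ _)

theorem integrableOn_rpow_mul_heatKer {b p : ℝ} {k : ℕ} (hp : p - (b + k) < -1) :
    IntegrableOn (fun t => t ^ p * heatKer b k t) (Ioi 0) := by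
  have hm : Measurable (fun t => t ^ p * heatKer b k t) :=
    (measurable_id.pow_const p).mul (measurable_heatKer b k)
  rw [← Ioc_union_Ioi_eq_Ioi zero_le_one]
  have key : ∀ a : ℝ, 0 ≤ a → ∃ C : ℝ, ∀ t : ℝ, 0 < t →
      ‖t ^ p * heatKer b k t‖ ≤ C * t ^ (p + (a - (b + k))) := by
    intro a ha
    obtain ⟨C, -, hC⟩ := exists_abs_heatKer_le b k ha
    refine ⟨C, fun t ht => ?_⟩
    have htp : 0 < t ^ p := Real.rpow_pos_of_pos ht p
    rw [Real.norm_eq_abs, abs_mul, abs_of_pos htp, Real.rpow_add ht]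
    nlinarith [hC t ht]
  refine IntegrableOn.union ?_ ?_
  · obtain ⟨C, hC⟩ := key (b + k - p) (by linarith)
    have h1 : IntegrableOn (fun u : ℝ => C * u ^ (p + (b + k - p - (b + k)))) (Ioc 0 1) :=
      ((intervalIntegrable_iff_integrableOn_Ioc_of_le zero_le_one).1
        (intervalIntegral.intervalIntegrable_rpow' (by linarith))).const_mul C
    refine h1.mono' hm.aestronglyMeasurable ?_
    filter_upwards [ae_restrict_mem measurableSet_Ioc] with u hu using hC u hu.1
  · obtain ⟨C, hC⟩ := key 0 le_rfl
    refine ((integrableOn_Ioi_rpow_of_lt (show p + (0 - (b + k)) < -1 by linarith)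
      zero_lt_one).const_mul C).mono'
      hm.aestronglyMeasurable ?_
    filter_upwards [ae_restrict_mem measurableSet_Ioi] with u hu using hC u (zero_lt_one.trans hu)

theorem tendsto_rpow_mul_heatKer_atTop {b p : ℝ} {k : ℕ} (hp : p < b + k) :
    Tendsto (fun t => t ^ p * heatKer b k t) atTop (𝓝 0) := by
  obtain ⟨C, -, hC⟩ := exists_abs_heatKer_le b k le_rfl
  have h := (tendsto_rpow_neg_atTop (show 0 < b + k - p by linarith)).const_mul C
  rw [mul_zero] at h
  refine squeeze_zero_norm' ?_ h
  filter_upwards [eventually_gt_atTop 0] with t ht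
  have htp : 0 < t ^ p := Real.rpow_pos_of_pos ht p
  rw [Real.norm_eq_abs, abs_mul, abs_of_pos htp,
    show -(b + k - p) = p + (0 - (b + k)) by ring, Real.rpow_add ht]
  nlinarith [hC t ht]

theorem tendsto_rpow_mul_heatKer_zero (b p : ℝ) (k : ℕ) :
    Tendsto (fun t => t ^ p * heatKer b k t) (𝓝[>] 0) (𝓝 0) := by
  obtain ⟨C, -, hC⟩ := exists_abs_heatKer_le b k (show 0 ≤ |b + k - p| + 1 by positivity)
  set q := p + (|b + k - p| + 1 - (b + k)) with hq
  have hq0 : 0 < q := by linarith [le_abs_self (b + k - p)]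
  have h : Tendsto (fun t : ℝ => C * t ^ q) (𝓝[>] 0) (𝓝 0) := by
    have : Tendsto (fun t : ℝ => C * t ^ q) (𝓝 0) (𝓝 (C * 0 ^ q)) :=
      (continuous_const.mul (continuous_id.rpow_const fun _ => Or.inr hq0.le)).tendsto 0
    rw [Real.zero_rpow hq0.ne', mul_zero] at this
    exact this.mono_left nhdsWithin_le_nhds
  refine squeeze_zero_norm' ?_ h
  filter_upwards [self_mem_nhdsWithin] with t (ht : 0 < t)
  have htp : 0 < t ^ p := Real.rpow_pos_of_pos ht p
  rw [Real.norm_eq_abs, abs_mul, abs_of_pos htp, hq, Real.rpow_add ht]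
  nlinarith [hC t ht]

/-- Integration by parts for the Mellin transform of `heatKer`. -/
theorem integral_rpow_mul_heatKer_succ {b p : ℝ} {k : ℕ} (hp : p < b + k) :
    ∫ t in Ioi (0 : ℝ), t ^ p * heatKer b (k + 1) t =
      p * ∫ t in Ioi (0 : ℝ), t ^ (p - 1) * heatKer b k t := by
  have h := integral_Ioi_mul_deriv_eq_deriv_mul (a := 0) (a' := (0 : ℝ)) (b' := 0)
    (u := fun t : ℝ => t ^ p) (u' := fun t => p * t ^ (p - 1)) (v := heatKer b k)
    (v' := fun t => -heatKer b (k + 1) t)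
    (fun t ht => Real.hasDerivAt_rpow_const (Or.inl (ne_of_gt ht)))
    (fun t ht => hasDerivAt_heatKer b k ht)
    (by
      have := (integrableOn_rpow_mul_heatKer (b := b) (p := p) (k := k + 1)
        (by push_cast; linarith)).neg
      refine this.congr_fun (fun t _ => ?_) measurableSet_Ioi
      simp)
    (by
      have : IntegrableOn (fun t => p * (t ^ (p - 1) * heatKer b k t)) (Ioi 0) :=
        (integrableOn_rpow_mul_heatKer (by linarith)).const_mul p
      refine this.congr_fun (fun t _ => ?_) measurableSet_Ioi
      simp [mul_assoc])
    (tendsto_rpow_mul_heatKer_zero b p k) (tendsto_rpow_mul_heatKer_atTop hp)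
  simp only [mul_neg, integral_neg, sub_zero, zero_sub, neg_inj, mul_assoc] at h
  rw [h, integral_const_mul]

theorem integral_rpow_mul_heatKer_zero {b q : ℝ} (hq : 0 < b + q) :
    ∫ t in Ioi (0 : ℝ), t ^ (-q - 1) * heatKer b 0 t = 4 ^ (b + q) * Real.Gamma (b + q) := by
  -- The substitution z = 1/t turns the integral into a Gamma integral of rate 1/4.
  have h := integral_comp_rpow_Ioi
    (fun z : ℝ => z ^ (b + q - 1) * Real.exp (-(1 / 4 * z))) (p := -1) (by norm_num)
  rw [Real.integral_rpow_mul_exp_neg_mul_Ioi hq (by norm_num)] at h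
  rw [show (4 : ℝ) = 1 / (1 / 4) by norm_num, ← h]
  refine setIntegral_congr_fun measurableSet_Ioi fun t ht => ?_
  have ht0 : (0 : ℝ) < t := ht
  simp only [heatKer, heatPoly, Polynomial.eval_one, abs_neg, abs_one, one_mul, smul_eq_mul,
    Real.rpow_neg_one, Nat.cast_zero, add_zero, mul_one]
  rw [Real.inv_rpow ht0.le, ← Real.rpow_neg ht0.le, ← mul_assoc, ← mul_assoc, ← Real.rpow_add ht0,
    ← Real.rpow_add ht0]
  congr 2 <;> ring

/-- No pole needs excluding: the default value 0 of `Real.Gamma` there makes the reciprocal vanish,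
as the entire function 1/Γ does. -/
theorem inv_Gamma_eq_mul_inv_Gamma_add_one (s : ℝ) :
    (Real.Gamma s)⁻¹ = s * (Real.Gamma (s + 1))⁻¹ := by
  rcases eq_or_ne s 0 with rfl | hs
  · simp
  · rw [Real.Gamma_add_one hs, mul_inv, mul_inv_cancel_left₀ hs]

/-- The left side does not depend on k: the factor k - q from integration by parts cancels against
the recurrence of 1/Γ. Flatness of the kernel at 0 lets the descent reach k = 0 even when q ≥ 0. -/
theorem inv_Gamma_mul_integral_rpow_mul_heatKer {b q : ℝ} (hq : 0 < b + q) (k : ℕ) :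
    (Real.Gamma (k - q))⁻¹ * ∫ t in Ioi (0 : ℝ), t ^ (k - q - 1) * heatKer b k t =
      (Real.Gamma (-q))⁻¹ * (4 ^ (b + q) * Real.Gamma (b + q)) := by
  induction k with
  | zero => rw [Nat.cast_zero, zero_sub, integral_rpow_mul_heatKer_zero hq]
  | succ k ih =>
    have h1 : ((k + 1 : ℕ) : ℝ) - q - 1 = k - q := by push_cast; ring
    have h2 : ((k + 1 : ℕ) : ℝ) - q = k - q + 1 := by push_cast; ring
    rw [h1, h2, integral_rpow_mul_heatKer_succ (by linarith), ← ih,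
      inv_Gamma_eq_mul_inv_Gamma_add_one (k - q)]
    ring

/-- This is Euler's reflection formula. At integers q ≥ 0 both sides are 0, which covers the even ϰ
for which the limit vanishes. -/
theorem inv_Gamma_neg {q : ℝ} (hq : -1 < q) :
    (Real.Gamma (-q))⁻¹ = Real.Gamma (q + 1) * Real.cos ((2 * q + 1) / 2 * Real.pi) / Real.pi := by
  have h := Real.Gamma_mul_Gamma_one_sub (-q)
  rw [sub_neg_eq_add, add_comm 1 q] at h
  have hG : Real.Gamma (q + 1) ≠ 0 := (Real.Gamma_pos_of_pos (by linarith)).ne'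
  rw [eq_div_of_mul_eq hG h, show (2 * q + 1) / 2 * Real.pi = q * Real.pi + Real.pi / 2 by ring,
    Real.cos_add_pi_div_two, mul_neg, Real.sin_neg, inv_div, div_div_eq_mul_div, mul_comm q]

/-- The smoothed Mellin transforms are bounded and converge as the smoothing parameter tends to
zero. -/
theorem exists_abs_integral_rpow_mul_heatKer_add_le {b p : ℝ} {k : ℕ} (hp0 : -1 < p)
    (hp : p - (b + k) < -1) :
    (∃ C : ℝ, ∀ δ : ℝ, 0 < δ →
      |∫ t in Ioi (0 : ℝ), t ^ p * heatKer b k (δ + t)| ≤ C) ∧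
    Tendsto (fun δ : ℝ => ∫ t in Ioi (0 : ℝ), t ^ p * heatKer b k (δ + t)) (𝓝[>] 0)
      (𝓝 (∫ t in Ioi (0 : ℝ), t ^ p * heatKer b k t)) := by
  have hbk : 0 ≤ b + k := by linarith
  obtain ⟨C, hC0, hC⟩ := exists_abs_heatKer_le b k le_rfl
  obtain ⟨D, hD0, hD⟩ := exists_abs_heatKer_le b k hbk
  -- A majorant independent of δ: near 0 the kernel is bounded (a = b + k), and beyond 1 its
  -- decreasing power bound (a = 0) at δ + t is at most the one at t.
  let g : ℝ → ℝ := fun t => if t ≤ 1 then D * t ^ p else C * t ^ (p + (0 - (b + k)))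
  have hg : IntegrableOn g (Ioi 0) := by
    rw [← Ioc_union_Ioi_eq_Ioi zero_le_one]
    refine IntegrableOn.union ?_ ?_
    · have h1 : IntegrableOn (fun u : ℝ => D * u ^ p) (Ioc 0 1) :=
        ((intervalIntegrable_iff_integrableOn_Ioc_of_le zero_le_one).1
          (intervalIntegral.intervalIntegrable_rpow' hp0)).const_mul D
      exact h1.congr_fun (fun t ht => by simp [g, ht.2]) measurableSet_Ioc
    · have h1 : IntegrableOn (fun u : ℝ => C * u ^ (p + (0 - (b + k)))) (Ioi 1) :=
        (integrableOn_Ioi_rpow_of_lt (by linarith) zero_lt_one).const_mul C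
      exact h1.congr_fun (fun t ht => by simp [g, not_le.2 (mem_Ioi.1 ht)]) measurableSet_Ioi
  have hbound : ∀ δ : ℝ, 0 < δ → ∀ᵐ t ∂(volume.restrict (Ioi (0 : ℝ))),
      ‖t ^ p * heatKer b k (δ + t)‖ ≤ g t := by
    intro δ hδ
    filter_upwards [ae_restrict_mem measurableSet_Ioi] with t (ht : 0 < t)
    have htp : 0 < t ^ p := Real.rpow_pos_of_pos ht p
    rw [Real.norm_eq_abs, abs_mul, abs_of_pos htp]
    by_cases h : t ≤ 1
    · have := hD (δ + t) (by linarith)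
      rw [sub_self, Real.rpow_zero, mul_one] at this
      simp only [g, h, if_true]
      rw [mul_comm D]
      gcongr
    · have h2 : (δ + t) ^ (0 - (b + k)) ≤ t ^ (0 - (b + k)) :=
        Real.rpow_le_rpow_of_nonpos ht (by linarith) (by linarith)
      simp only [g, h, if_false]
      rw [Real.rpow_add ht]
      calc t ^ p * |heatKer b k (δ + t)| ≤ t ^ p * (C * t ^ (0 - (b + k))) := by
            gcongr
            exact (hC _ (by linarith)).trans (by gcongr)
        _ = _ := by ring
  refine ⟨⟨∫ t in Ioi (0 : ℝ), g t, fun δ hδ => norm_integral_le_of_norm_le hg (hbound δ hδ)⟩, ?_⟩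
  refine tendsto_integral_filter_of_dominated_convergence g ?_ ?_ hg ?_
  · refine Eventually.of_forall fun δ => Measurable.aestronglyMeasurable ?_
    exact (measurable_id.pow_const p).mul ((measurable_heatKer b k).comp (measurable_const_add δ))
  · filter_upwards [self_mem_nhdsWithin] with δ hδ using hbound δ hδ
  · filter_upwards [ae_restrict_mem measurableSet_Ioi] with t (ht : 0 < t)
    have hc : ContinuousAt (heatKer b k) t := (hasDerivAt_heatKer b k ht).continuousAt
    have h1 : Tendsto (fun δ : ℝ => δ + t) (𝓝[>] 0) (𝓝 t) := by
      have : Tendsto (fun δ : ℝ => δ + t) (𝓝 0) (𝓝 (0 + t)) :=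
        (continuous_add_const t).tendsto 0
      rw [zero_add] at this
      exact this.mono_left nhdsWithin_le_nhds
    exact (hc.tendsto.comp h1).const_mul _

end HeatKernel

/-! ### Fourier transforms of powers of the norm with Gaussian damping. -/

section Gaussian

variable {V : Type*} [NormedAddCommGroup V] [InnerProductSpace ℝ V] [FiniteDimensional ℝ V]
  [MeasurableSpace V] [BorelSpace V]

theorem integrable_norm_rpow_mul_exp [Nontrivial V] {s p c : ℝ}
    (hs : -(Module.finrank ℝ V : ℝ) < s) (hp : 0 < p) (hc : 0 < c) :
    Integrable (fun v : V => ‖v‖ ^ s * Real.exp (-(c * ‖v‖ ^ p))) := by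
  have hd : 1 ≤ Module.finrank ℝ V := Module.finrank_pos
  have h := (integrable_fun_norm_addHaar (volume : Measure V)
    (f := fun y : ℝ => y ^ s * Real.exp (-(c * y ^ p)))).2
  refine h ?_
  refine (integrableOn_rpow_mul_exp_neg_mul_rpow (p := p) (b := c)
    (s := (Module.finrank ℝ V - 1 : ℕ) + s) ?_ hp hc).congr_fun (fun y hy => ?_) measurableSet_Ioi
  · rw [Nat.cast_sub hd]
    push_cast
    linarith
  · have hy0 : (0 : ℝ) < y := hy
    simp only [smul_eq_mul]
    rw [Real.rpow_add hy0, Real.rpow_natCast, neg_mul, mul_assoc]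

theorem integrable_norm_pow_mul_exp_sq [Nontrivial V] (k : ℕ) {c : ℝ} (hc : 0 < c) :
    Integrable (fun v : V => ‖v‖ ^ (2 * k) * Real.exp (-(c * ‖v‖ ^ 2))) := by
  have h := integrable_norm_rpow_mul_exp (V := V) (s := (2 * k : ℕ)) (p := 2) (c := c)
    (by
      have : 0 < (Module.finrank ℝ V : ℝ) := by exact_mod_cast Module.finrank_pos
      have h2 : (0 : ℝ) ≤ (2 * k : ℕ) := by positivity
      linarith) (by norm_num) hc
  simpa only [Real.rpow_natCast, Real.rpow_two] using h

theorem norm_cexp_I_mul_ofReal (y : ℝ) : ‖Complex.exp (Complex.I * (y : ℂ))‖ = 1 := by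
  rw [mul_comm]
  exact Complex.norm_exp_ofReal_mul_I y

/-- The Fourier transform of `‖v‖ ^ (2k) exp (-t ‖v‖²)` at a unit vector. -/
theorem integral_norm_pow_mul_exp_sq_mul_cexp [Nontrivial V] {θ : V} (hθ : ‖θ‖ = 1) (k : ℕ)
    {t : ℝ} (ht : 0 < t) :
    ∫ v : V, ((‖v‖ ^ (2 * k) * Real.exp (-(t * ‖v‖ ^ 2)) : ℝ) : ℂ) *
        Complex.exp (Complex.I * (inner ℝ θ v : ℝ)) =
      ((Real.pi ^ ((Module.finrank ℝ V : ℝ) / 2) *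
        heatKer ((Module.finrank ℝ V : ℝ) / 2) k t : ℝ) : ℂ) := by
  set b := (Module.finrank ℝ V : ℝ) / 2 with hb
  induction k generalizing t with
  | zero =>
    have h := GaussianFourier.integral_cexp_neg_mul_sq_norm_add (V := V) (b := (t : ℂ))
      (by simpa using ht) Complex.I θ
    have hL : ∀ v : V, ((‖v‖ ^ (2 * 0) * Real.exp (-(t * ‖v‖ ^ 2)) : ℝ) : ℂ) *
        Complex.exp (Complex.I * (inner ℝ θ v : ℝ)) =
        Complex.exp (-(t : ℂ) * ‖v‖ ^ 2 + Complex.I * (inner ℝ θ v : ℝ)) := by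
      intro v
      rw [Complex.exp_add]
      push_cast
      simp
    simp_rw [hL]
    rw [h, hθ, Complex.I_sq]
    have hR : ((Real.pi : ℂ) / t) ^ ((Module.finrank ℝ V : ℂ) / 2) =
        ((Real.pi ^ b * t ^ (-b) : ℝ) : ℂ) := by
      rw [Real.rpow_neg ht.le, ← div_eq_mul_inv, ← Real.div_rpow Real.pi_pos.le ht.le,
        Complex.ofReal_cpow (by positivity)]
      push_cast [hb]
      rfl
    rw [hR]
    simp only [heatKer, heatPoly, Polynomial.eval_one, Nat.cast_zero, add_zero, mul_one]
    push_cast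
    rw [mul_assoc]
    congr 3
    field_simp
  | succ k ih =>
    let F : ℝ → V → ℂ := fun t v => ((‖v‖ ^ (2 * k) * Real.exp (-(t * ‖v‖ ^ 2)) : ℝ) : ℂ) *
        Complex.exp (Complex.I * (inner ℝ θ v : ℝ))
    let F' : ℝ → V → ℂ := fun t v =>
      -(((‖v‖ ^ (2 * (k + 1)) * Real.exp (-(t * ‖v‖ ^ 2)) : ℝ) : ℂ) *
        Complex.exp (Complex.I * (inner ℝ θ v : ℝ)))
    have hFc : ∀ t, Continuous (F t) := fun t => by fun_prop
    have hF'c : ∀ t, Continuous (F' t) := fun t => by fun_prop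
    -- Each application of -d/dt brings down one factor ‖v‖². Restricting to s > t/2 gives a
    -- Gaussian majorant uniform in s.
    have key := (hasDerivAt_integral_of_dominated_loc_of_deriv_le (μ := (volume : Measure V))
      (F := F) (F' := F') (x₀ := t) (s := Ioi (t / 2))
      (bound := fun v => ‖v‖ ^ (2 * (k + 1)) * Real.exp (-(t / 2 * ‖v‖ ^ 2)))
      (Ioi_mem_nhds (by linarith)) (Eventually.of_forall fun t => (hFc t).aestronglyMeasurable)
      (by
        refine (integrable_norm_pow_mul_exp_sq (V := V) k ht).mono'
          (hFc t).aestronglyMeasurable (ae_of_all _ fun v => ?_)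
        simp only [F]
        rw [norm_mul, norm_cexp_I_mul_ofReal, mul_one, Complex.norm_real,
          Real.norm_of_nonneg (by positivity)])
      (hF'c t).aestronglyMeasurable
      (by
        refine ae_of_all _ fun v s hs => ?_
        simp only [F']
        rw [norm_neg, norm_mul, norm_cexp_I_mul_ofReal, mul_one, Complex.norm_real,
          Real.norm_of_nonneg (by positivity)]
        have : t / 2 ≤ s := le_of_lt hs
        gcongr)
      (integrable_norm_pow_mul_exp_sq (V := V) (k + 1) (by linarith))
      (by
        refine ae_of_all _ fun v s _ => ?_
        have h1 : HasDerivAt (fun s : ℝ => ‖v‖ ^ (2 * k) * Real.exp (-(s * ‖v‖ ^ 2)))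
            (‖v‖ ^ (2 * k) * (Real.exp (-(s * ‖v‖ ^ 2)) * -(1 * ‖v‖ ^ 2))) s :=
          (((hasDerivAt_id s).mul_const (‖v‖ ^ 2)).neg.exp).const_mul _
        refine (h1.ofReal_comp.mul_const _).congr_deriv ?_
        simp only [F']
        push_cast
        ring)).2
    have h2 : HasDerivAt (fun t => ((Real.pi ^ b * heatKer b k t : ℝ) : ℂ))
        ((Real.pi ^ b * -heatKer b (k + 1) t : ℝ) : ℂ) t :=
      ((hasDerivAt_heatKer b k ht).const_mul _).ofReal_comp
    have h3 : (fun t => ((Real.pi ^ b * heatKer b k t : ℝ) : ℂ)) =ᶠ[𝓝 t]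
        fun t => ∫ v, F t v := by
      filter_upwards [Ioi_mem_nhds ht] with s hs using (ih hs).symm
    have h4 := (key.congr_of_eventuallyEq h3).unique h2
    simp only [F', integral_neg] at h4
    rw [neg_eq_iff_eq_neg] at h4
    rw [h4]
    push_cast
    ring

/-- The Fourier transform of `‖v‖ ^ ϰ exp (-δ ‖v‖²)` at a unit vector, as a superposition of
heat kernels. -/
theorem integral_norm_rpow_mul_exp_sq_mul_cexp [Nontrivial V] {θ : V} (hθ : ‖θ‖ = 1) {ϰ : ℝ}
    (hϰ : -(Module.finrank ℝ V : ℝ) < ϰ) {k : ℕ} (hk : ϰ / 2 < k) {δ : ℝ} (hδ : 0 < δ) :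
    ∫ v : V, ((‖v‖ ^ ϰ * Real.exp (-(δ * ‖v‖ ^ 2)) : ℝ) : ℂ) *
        Complex.exp (Complex.I * (inner ℝ θ v : ℝ)) =
      (((Real.Gamma (k - ϰ / 2))⁻¹ * (Real.pi ^ ((Module.finrank ℝ V : ℝ) / 2) *
        ∫ t in Ioi (0 : ℝ), t ^ (k - ϰ / 2 - 1) *
          heatKer ((Module.finrank ℝ V : ℝ) / 2) k (δ + t)) : ℝ) : ℂ) := by
  set b := (Module.finrank ℝ V : ℝ) / 2 with hb
  set κ := (k : ℝ) - ϰ / 2 with hκ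
  have hκ0 : 0 < κ := by linarith
  have hΓ : Real.Gamma κ ≠ 0 := (Real.Gamma_pos_of_pos hκ0).ne'
  let g : V → ℝ → ℝ := fun v t =>
    ‖v‖ ^ (2 * k) * Real.exp (-(δ * ‖v‖ ^ 2)) * (t ^ (κ - 1) * Real.exp (-(‖v‖ ^ 2 * t)))
  let G : V → ℝ → ℂ := fun v t => (g v t : ℂ) * Complex.exp (Complex.I * (inner ℝ θ v : ℝ))
  have hg0 : ∀ v t, 0 < t → 0 ≤ g v t := fun v t ht => by positivity
  have hae : ∀ᵐ v : V, v ≠ 0 := by simp [ae_iff]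
  -- The Gamma integral yields Γ(κ) ‖v‖^(-2κ), and 2k - 2κ = ϰ. The origin is excluded because there
  -- the t-integral can diverge.
  have hgint : ∀ v : V, v ≠ 0 → ∫ t in Ioi (0 : ℝ), g v t =
      ‖v‖ ^ ϰ * Real.exp (-(δ * ‖v‖ ^ 2)) * Real.Gamma κ := by
    intro v hv
    have hv0 : 0 < ‖v‖ := norm_pos_iff.2 hv
    simp only [g]
    rw [integral_const_mul, Real.integral_rpow_mul_exp_neg_mul_Ioi hκ0 (by positivity)]
    have : ‖v‖ ^ (2 * k) * (1 / ‖v‖ ^ 2) ^ κ = ‖v‖ ^ ϰ := by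
      rw [one_div, ← Real.rpow_natCast, ← Real.rpow_natCast, Real.inv_rpow (by positivity),
        ← Real.rpow_neg (by positivity), ← Real.rpow_mul hv0.le, ← Real.rpow_add hv0]
      congr 1
      push_cast [hκ]
      ring
    rw [← this]
    ring
  have hnorm : ∀ v t, 0 < t → ‖G v t‖ = g v t := fun v t ht => by
    simp only [G]
    rw [norm_mul, norm_cexp_I_mul_ofReal, mul_one, Complex.norm_real,
      Real.norm_of_nonneg (hg0 v t ht)]
  have hGm : Measurable (Function.uncurry G) := by
    have : Measurable (fun p : V × ℝ => g p.1 p.2) := by fun_prop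
    have h2 : Measurable (fun p : V × ℝ => Complex.exp (Complex.I * (inner ℝ θ p.1 : ℝ))) := by
      have : Continuous (fun p : V × ℝ => Complex.exp (Complex.I * (inner ℝ θ p.1 : ℝ))) := by
        fun_prop
      exact this.measurable
    exact (Complex.measurable_ofReal.comp this).mul h2
  have hGi : Integrable (Function.uncurry G)
      ((volume : Measure V).prod (volume.restrict (Ioi (0 : ℝ)))) := by
    rw [integrable_prod_iff hGm.aestronglyMeasurable]
    constructor
    · filter_upwards [hae] with v hv
      have hv0 : 0 < ‖v‖ := norm_pos_iff.2 hv
      have h1 := (integrableOn_rpow_mul_exp_neg_mul_rpow (s := κ - 1) (p := 1) (b := ‖v‖ ^ 2)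
        (by linarith) one_pos (by positivity)).const_mul
          (‖v‖ ^ (2 * k) * Real.exp (-(δ * ‖v‖ ^ 2)))
      refine h1.mono' (hGm.comp measurable_prodMk_left).aestronglyMeasurable ?_
      filter_upwards [ae_restrict_mem measurableSet_Ioi] with t ht
      refine (hnorm v t ht).le.trans (le_of_eq ?_)
      simp only [g, Real.rpow_one, neg_mul]
    · have h1 := (integrable_norm_rpow_mul_exp (V := V) (p := 2) hϰ (by norm_num) hδ).mul_const
        (Real.Gamma κ)
      refine h1.congr ?_
      filter_upwards [hae] with v hv
      simp only [Real.rpow_two]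
      rw [← hgint v hv]
      exact setIntegral_congr_fun measurableSet_Ioi fun t ht => (hnorm v t ht).symm
  have hswap := integral_integral_swap hGi
  have hl : ∫ v : V, ∫ t in Ioi (0 : ℝ), G v t = (Real.Gamma κ : ℂ) *
      ∫ v : V, ((‖v‖ ^ ϰ * Real.exp (-(δ * ‖v‖ ^ 2)) : ℝ) : ℂ) *
        Complex.exp (Complex.I * (inner ℝ θ v : ℝ)) := by
    rw [← integral_const_mul]
    refine integral_congr_ae ?_
    filter_upwards [hae] with v hv
    simp only [G]
    rw [integral_mul_const, integral_complex_ofReal, hgint v hv]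
    push_cast
    ring
  have hr : ∫ t in Ioi (0 : ℝ), ∫ v : V, G v t =
      ((Real.pi ^ b * ∫ t in Ioi (0 : ℝ), t ^ (κ - 1) * heatKer b k (δ + t) : ℝ) : ℂ) := by
    rw [← integral_const_mul, ← integral_complex_ofReal]
    refine setIntegral_congr_fun measurableSet_Ioi fun t ht => ?_
    have ht0 : (0 : ℝ) < t := ht
    have h1 := integral_norm_pow_mul_exp_sq_mul_cexp hθ k (show 0 < δ + t by linarith)
    have h2 : ∀ v : V, G v t = ((t ^ (κ - 1) : ℝ) : ℂ) *
        (((‖v‖ ^ (2 * k) * Real.exp (-((δ + t) * ‖v‖ ^ 2)) : ℝ) : ℂ) *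
        Complex.exp (Complex.I * (inner ℝ θ v : ℝ))) := by
      intro v
      simp only [G, g]
      rw [show -((δ + t) * ‖v‖ ^ 2) = -(δ * ‖v‖ ^ 2) + -(‖v‖ ^ 2 * t) by ring, Real.exp_add]
      push_cast
      ring
    simp_rw [h2]
    rw [integral_const_mul, h1]
    push_cast
    ring
  rw [hl, hr] at hswap
  have hΓ' : (Real.Gamma κ : ℂ) ≠ 0 := by exact_mod_cast hΓ
  rw [Complex.ofReal_mul, ← hswap, Complex.ofReal_inv, inv_mul_cancel_left₀ hΓ']

end Gaussian

/-! ### Rescaling, mixing over the subordinator and passage to the limit. -/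

theorem stableIntegrand_eq (d : ℕ) (α ϰ : ℝ) (x v : EuclideanSpace ℝ (Fin d)) :
    stableIntegrand d α ϰ x v = ((‖v‖ ^ ϰ * Real.exp (-‖v‖ ^ α) : ℝ) : ℂ) *
      Complex.exp (Complex.I * (inner ℝ x v : ℝ)) := by
  rw [stableIntegrand, sub_eq_add_neg, Complex.exp_add]
  push_cast
  ring

theorem measurable_stableIntegrand (d : ℕ) (α ϰ : ℝ) (x : EuclideanSpace ℝ (Fin d)) :
    Measurable (stableIntegrand d α ϰ x) := by
  unfold stableIntegrand
  have h : Measurable fun v : EuclideanSpace ℝ (Fin d) => (inner ℝ x v : ℝ) := by fun_prop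
  fun_prop

theorem integrable_stableIntegrand {d : ℕ} (hd : 1 ≤ d) {α ϰ : ℝ} (hα : 0 < α)
    (hϰ : -(d : ℝ) < ϰ) (x : EuclideanSpace ℝ (Fin d)) :
    Integrable (stableIntegrand d α ϰ x) := by
  have : Nonempty (Fin d) := ⟨⟨0, hd⟩⟩
  refine (integrable_norm_rpow_mul_exp (V := EuclideanSpace ℝ (Fin d)) (s := ϰ) (c := 1)
    (by simpa using hϰ) hα one_pos).mono' (measurable_stableIntegrand d α ϰ x).aestronglyMeasurable
    (ae_of_all _ fun v => ?_)
  rw [stableIntegrand_eq, norm_mul, norm_cexp_I_mul_ofReal, mul_one, Complex.norm_real,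
    Real.norm_of_nonneg (by positivity), one_mul]

/-- Rescaling the integral by `‖x‖`. -/
theorem norm_rpow_mul_integral_stableIntegrand {d : ℕ} (α ϰ : ℝ)
    {x : EuclideanSpace ℝ (Fin d)} (hx : x ≠ 0) :
    ((‖x‖ ^ ((d : ℝ) + ϰ) : ℝ) : ℂ) * ∫ v, stableIntegrand d α ϰ x v =
      ∫ v : EuclideanSpace ℝ (Fin d), ((‖v‖ ^ ϰ * Real.exp (-(‖v‖ / ‖x‖) ^ α) : ℝ) : ℂ) *
        Complex.exp (Complex.I * (inner ℝ (‖x‖⁻¹ • x) v : ℝ)) := by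
  have hr : 0 < ‖x‖ := norm_pos_iff.2 hx
  have h := Measure.integral_comp_inv_smul_of_nonneg (volume : Measure (EuclideanSpace ℝ (Fin d)))
    (stableIntegrand d α ϰ x) hr.le
  have hpow : ((‖x‖ ^ ((d : ℝ) + ϰ) : ℝ) : ℂ) * ∫ v, stableIntegrand d α ϰ x v =
      ((‖x‖ ^ ϰ : ℝ) : ℂ) * (‖x‖ ^ d • ∫ v, stableIntegrand d α ϰ x v) := by
    rw [Real.rpow_add hr, Real.rpow_natCast, Complex.real_smul]
    push_cast
    ring
  rw [finrank_euclideanSpace_fin] at h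
  rw [hpow, ← h, ← integral_const_mul]
  refine integral_congr_ae (ae_of_all _ fun v => ?_)
  simp only [stableIntegrand_eq, norm_smul, norm_inv, norm_norm, inner_smul_right,
    real_inner_smul_left]
  rw [Real.mul_rpow (by positivity) (by positivity), Real.inv_rpow hr.le, ← mul_assoc,
    ← Complex.ofReal_mul, inv_mul_eq_div]
  have := (Real.rpow_pos_of_pos hr ϰ).ne'
  congr 2
  field_simp

/-- Subordination turns the rescaled integral into a mixture of Gaussian ones. -/
theorem integral_norm_rpow_mul_exp_neg_rpow_mul_cexp {d : ℕ} (hd : 1 ≤ d) {α ϰ : ℝ} (hα : 0 < α)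
    (hϰ : -(d : ℝ) < ϰ) {μ : Measure ℝ} [IsProbabilityMeasure μ] (hpos : ∀ᵐ u ∂μ, 0 < u)
    (hμ : ∀ s : ℝ, 0 < s → ∫ u, Real.exp (-(u * s)) ∂μ = Real.exp (-s ^ (α / 2)))
    {r : ℝ} (hr : 0 < r) (θ : EuclideanSpace ℝ (Fin d)) :
    ∫ v : EuclideanSpace ℝ (Fin d), ((‖v‖ ^ ϰ * Real.exp (-(‖v‖ / r) ^ α) : ℝ) : ℂ) *
        Complex.exp (Complex.I * (inner ℝ θ v : ℝ)) =
      ∫ u, (∫ v : EuclideanSpace ℝ (Fin d),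
        ((‖v‖ ^ ϰ * Real.exp (-(u / r ^ 2 * ‖v‖ ^ 2)) : ℝ) : ℂ) *
        Complex.exp (Complex.I * (inner ℝ θ v : ℝ))) ∂μ := by
  have : Nonempty (Fin d) := ⟨⟨0, hd⟩⟩
  let E := EuclideanSpace ℝ (Fin d)
  let g : E → ℝ → ℝ := fun v u => ‖v‖ ^ ϰ * Real.exp (-(u / r ^ 2 * ‖v‖ ^ 2))
  let G : E → ℝ → ℂ := fun v u => (g v u : ℂ) * Complex.exp (Complex.I * (inner ℝ θ v : ℝ))
  have hg0 : ∀ v u, 0 ≤ g v u := fun v u => by positivity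
  have hae : ∀ᵐ v : E, v ≠ 0 := by simp [ae_iff]
  have hgint : ∀ v : E, v ≠ 0 → ∫ u, g v u ∂μ = ‖v‖ ^ ϰ * Real.exp (-(‖v‖ / r) ^ α) := by
    intro v hv
    have hv0 : 0 < ‖v‖ := norm_pos_iff.2 hv
    simp only [g]
    rw [integral_const_mul]
    have h1 := hμ ((‖v‖ / r) ^ 2) (by positivity)
    rw [← Real.rpow_natCast, ← Real.rpow_mul (by positivity),
      show ((2 : ℕ) : ℝ) * (α / 2) = α by push_cast; ring] at h1
    rw [← h1]
    congr 2
    ext u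
    rw [Real.rpow_natCast, div_pow]
    congr 2
    ring
  have hnorm : ∀ v u, ‖G v u‖ = g v u := fun v u => by
    simp only [G]
    rw [norm_mul, norm_cexp_I_mul_ofReal, mul_one, Complex.norm_real,
      Real.norm_of_nonneg (hg0 v u)]
  have hGm : Measurable (Function.uncurry G) := by
    have : Measurable (fun p : E × ℝ => g p.1 p.2) := by fun_prop
    have h2 : Measurable (fun p : E × ℝ => Complex.exp (Complex.I * (inner ℝ θ p.1 : ℝ))) := by
      have : Continuous (fun p : E × ℝ => Complex.exp (Complex.I * (inner ℝ θ p.1 : ℝ))) := by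
        fun_prop
      exact this.measurable
    exact (Complex.measurable_ofReal.comp this).mul h2
  have hGi : Integrable (Function.uncurry G) ((volume : Measure E).prod μ) := by
    rw [integrable_prod_iff hGm.aestronglyMeasurable]
    constructor
    · refine ae_of_all _ fun v => ?_
      refine Integrable.of_bound (hGm.comp measurable_prodMk_left).aestronglyMeasurable
        (‖v‖ ^ ϰ) ?_
      filter_upwards [hpos] with u hu
      refine (hnorm v u).le.trans ?_
      refine mul_le_of_le_one_right (by positivity) (Real.exp_le_one_iff.2 ?_)
      have : 0 ≤ u / r ^ 2 * ‖v‖ ^ 2 := by positivity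
      linarith
    · have h1 := integrable_norm_rpow_mul_exp (V := E) (s := ϰ) (c := (r ^ α)⁻¹)
        (by simpa [E] using hϰ) hα (by positivity)
      refine h1.congr ?_
      filter_upwards [hae] with v hv
      simp only [Function.uncurry_apply_pair, hnorm]
      rw [hgint v hv, Real.div_rpow (norm_nonneg v) hr.le, div_eq_inv_mul]
  rw [← integral_integral_swap hGi]
  refine integral_congr_ae ?_
  filter_upwards [hae] with v hv
  simp only [G]
  rw [integral_mul_const, integral_complex_ofReal, hgint v hv]

/-- For each u > 0 the argument u/r² tends to 0 from the right, and the constant C dominates, so no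
moment of μ is required. -/
theorem tendsto_integral_mixture {J : ℝ → ℝ} {C J₀ : ℝ} (hJm : Measurable J)
    (hC : ∀ δ : ℝ, 0 < δ → |J δ| ≤ C) (hJ : Tendsto J (𝓝[>] 0) (𝓝 J₀))
    {μ : Measure ℝ} [IsProbabilityMeasure μ] (hpos : ∀ᵐ u ∂μ, 0 < u) :
    Tendsto (fun r : ℝ => ∫ u, J (u / r ^ 2) ∂μ) atTop (𝓝 J₀) := by
  have h : Tendsto (fun r : ℝ => ∫ u, J (u / r ^ 2) ∂μ) atTop (𝓝 (∫ _, J₀ ∂μ)) := by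
    refine tendsto_integral_filter_of_dominated_convergence (fun _ => C)
      (Eventually.of_forall fun r =>
        (hJm.comp (measurable_id.div_const (r ^ 2))).aestronglyMeasurable) ?_
      (integrable_const C) ?_
    · filter_upwards [eventually_gt_atTop 0] with r hr
      filter_upwards [hpos] with u hu using hC _ (by positivity)
    · filter_upwards [hpos] with u hu
      refine hJ.comp (tendsto_nhdsWithin_iff.2 ⟨?_, ?_⟩)
      · exact (tendsto_pow_atTop two_ne_zero).const_div_atTop u
      · filter_upwards [eventually_gt_atTop 0] with r hr
        exact div_pos hu (by positivity)
  simpa using h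

theorem limit_constant_eq (d : ℕ) {ϰ : ℝ} (hϰ : -2 < ϰ) :
    1 / (2 * Real.pi) ^ d * (Real.pi ^ ((d : ℝ) / 2) * ((Real.Gamma (-(ϰ / 2)))⁻¹ *
      (4 ^ ((d : ℝ) / 2 + ϰ / 2) * Real.Gamma ((d : ℝ) / 2 + ϰ / 2)))) =
    (2 : ℝ) ^ ϰ / Real.pi ^ ((d : ℝ) / 2 + 1) *
        Real.Gamma (((d : ℝ) + ϰ) / 2) * Real.Gamma (ϰ / 2 + 1) *
        Real.cos ((ϰ + 1) / 2 * Real.pi) := by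
  have hπ := Real.pi_pos
  have h4 : (4 : ℝ) ^ ((d : ℝ) / 2 + ϰ / 2) = 2 ^ d * 2 ^ ϰ := by
    rw [show (4 : ℝ) = 2 ^ (2 : ℝ) by norm_num, ← Real.rpow_mul (by norm_num), ← Real.rpow_natCast,
      ← Real.rpow_add (by norm_num)]
    congr 1
    ring
  have hd2 : Real.pi ^ d = Real.pi ^ ((d : ℝ) / 2) * Real.pi ^ ((d : ℝ) / 2) := by
    rw [← Real.rpow_add hπ, ← Real.rpow_natCast]
    congr 1
    ring
  rw [inv_Gamma_neg (by linarith), h4, mul_pow, hd2, Real.rpow_add hπ, Real.rpow_one,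
    show 2 * (ϰ / 2) = ϰ by ring, show ((d : ℝ) + ϰ) / 2 = (d : ℝ) / 2 + ϰ / 2 by ring]
  have := (Real.rpow_pos_of_pos hπ ((d : ℝ) / 2)).ne'
  field_simp

theorem theorem2 (d : ℕ) (hd : 1 ≤ d) (α : ℝ) (hα0 : 0 < α) (hα2 : α < 2)
    (ϰ : ℝ) (hϰ : -(min (d : ℝ) 2) < ϰ) :
    (∀ x : EuclideanSpace ℝ (Fin d),
      MeasureTheory.Integrable (stableIntegrand d α ϰ x) MeasureTheory.volume) ∧
    Filter.Tendsto
      (fun x : EuclideanSpace ℝ (Fin d) => ((‖x‖ ^ ((d : ℝ) + ϰ) : ℝ) : ℂ) * stableD d α ϰ x)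
      (Filter.comap (fun x : EuclideanSpace ℝ (Fin d) => ‖x‖) Filter.atTop)
      (nhds (((2 : ℝ) ^ ϰ / Real.pi ^ ((d : ℝ) / 2 + 1) *
        Real.Gamma (((d : ℝ) + ϰ) / 2) * Real.Gamma (ϰ / 2 + 1) *
        Real.cos ((ϰ + 1) / 2 * Real.pi) : ℝ) : ℂ)) := by
  have hϰd : -(d : ℝ) < ϰ := by linarith [min_le_left (d : ℝ) 2]
  have hϰ2 : -2 < ϰ := by linarith [min_le_right (d : ℝ) 2]
  refine ⟨integrable_stableIntegrand hd hα0 hϰd, ?_⟩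
  have : Nonempty (Fin d) := ⟨⟨0, hd⟩⟩
  obtain ⟨μ, hprob, hpos, hμ⟩ :=
    exists_measure_integral_exp_eq_exp_neg_rpow (half_pos hα0) (by linarith : α / 2 < 1)
  obtain ⟨k, hk⟩ := exists_nat_gt (ϰ / 2)
  let J : ℝ → ℝ := fun δ => ∫ t in Ioi (0 : ℝ), t ^ (k - ϰ / 2 - 1) *
    heatKer ((d : ℝ) / 2) k (δ + t)
  have hJm : Measurable J := by
    have h : Measurable (fun p : ℝ × ℝ => p.2 ^ (k - ϰ / 2 - 1) *
        heatKer ((d : ℝ) / 2) k (p.1 + p.2)) :=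
      (measurable_snd.pow_const _).mul
        ((measurable_heatKer _ _).comp (measurable_fst.add measurable_snd))
    exact (h.stronglyMeasurable.integral_prod_right'
      (ν := volume.restrict (Ioi (0 : ℝ)))).measurable
  -- The two exponent conditions amount to k > ϰ/2 (convergence at t = 0) and ϰ > -d (convergence at
  -- infinity).
  obtain ⟨⟨C, hC⟩, hJ⟩ := exists_abs_integral_rpow_mul_heatKer_add_le
    (b := (d : ℝ) / 2) (p := k - ϰ / 2 - 1) (k := k) (by linarith) (by linarith)
  have hlim := ((tendsto_integral_mixture hJm hC hJ hpos).const_mul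
    ((2 * Real.pi) ^ d)⁻¹ |>.const_mul
      ((Real.Gamma (k - ϰ / 2))⁻¹ * Real.pi ^ ((d : ℝ) / 2))).ofReal
  have hconst : (Real.Gamma (k - ϰ / 2))⁻¹ * Real.pi ^ ((d : ℝ) / 2) * (((2 * Real.pi) ^ d)⁻¹ *
      ∫ t in Ioi (0 : ℝ), t ^ (k - ϰ / 2 - 1) * heatKer ((d : ℝ) / 2) k t) =
      (2 : ℝ) ^ ϰ / Real.pi ^ ((d : ℝ) / 2 + 1) *
        Real.Gamma (((d : ℝ) + ϰ) / 2) * Real.Gamma (ϰ / 2 + 1) *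
        Real.cos ((ϰ + 1) / 2 * Real.pi) := by
    rw [← limit_constant_eq d hϰ2,
      ← inv_Gamma_mul_integral_rpow_mul_heatKer (by linarith : 0 < (d : ℝ) / 2 + ϰ / 2) k]
    ring
  rw [hconst] at hlim
  refine (hlim.comp (tendsto_comap (f := fun x : EuclideanSpace ℝ (Fin d) => ‖x‖))).congr' ?_
  filter_upwards [tendsto_comap.eventually (eventually_gt_atTop (0 : ℝ))] with x hx
  have hx0 : x ≠ 0 := norm_pos_iff.1 hx
  have hθ : ‖‖x‖⁻¹ • x‖ = 1 := norm_smul_inv_norm hx0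
  have hmix : ∫ u, (∫ v : EuclideanSpace ℝ (Fin d),
        ((‖v‖ ^ ϰ * Real.exp (-(u / ‖x‖ ^ 2 * ‖v‖ ^ 2)) : ℝ) : ℂ) *
        Complex.exp (Complex.I * (inner ℝ (‖x‖⁻¹ • x) v : ℝ))) ∂μ =
      (((Real.Gamma (k - ϰ / 2))⁻¹ * (Real.pi ^ ((d : ℝ) / 2) *
        ∫ u, J (u / ‖x‖ ^ 2) ∂μ) : ℝ) : ℂ) := by
    rw [← integral_const_mul, ← integral_const_mul, ← integral_complex_ofReal]
    refine integral_congr_ae ?_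
    filter_upwards [hpos] with u hu
    rw [integral_norm_rpow_mul_exp_sq_mul_cexp hθ (by simpa using hϰd) hk (by positivity),
      finrank_euclideanSpace_fin]
  rw [stableD, mul_left_comm, norm_rpow_mul_integral_stableIntegrand α ϰ hx0,
    integral_norm_rpow_mul_exp_neg_rpow_mul_cexp hd hα0 hϰd hpos hμ hx, hmix]
  simp only [Function.comp_apply]
  push_cast
  ring
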